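/- Let $D$ be a compact metric space with a Radon (equivalently, finite Borel) measure $\lambda$, and let $\mu>0$. Let $\Phi$ be a Poisson point process on $D\times\mathbb{R}$ with intensity $2\lambda\otimes\ell$, where $\ell$ is Lebesgue measure, whose points $x=(p_x,b_x)$ (position and arrival time) carry i.i.d. marks $(c_x,w_x)\in\{\mathtt{R},\mathtt{B}\}\times\mathbb{R}^+$; the color $c_x$ is uniformly distributed, the patience $w_x$ is exponentially distributed with parameter $\mu$, and the two are independent. A time $t\in\mathbb{R}$ is called a regeneration time of $\Phi$ if $t-b_x>w_x$ for all $x\in\Phi$ with $b_x\le t$. Then, almost surely, infinitely many of the times $0,-1,-2,\ldots$ are regeneration times of $\Phi$. Moreover, $$\mathbb{P}(0\text{ is a regeneration time of }\Phi)\ \ge\ \exp\left(-\frac{2\lambda(D)}{\mu}\right)>0 .$$ -/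

import Mathlib

open MeasureTheory ProbabilityTheory Topology
open scoped ENNReal NNReal

/-- The two particle types. -/
inductive Color
  | red
  | blue
  deriving DecidableEq

instance : Fintype Color :=
  ⟨{Color.red, Color.blue}, fun c => by cases c <;> simp⟩

instance : Nonempty Color := ⟨Color.red⟩

instance : MeasurableSpace Color := ⊤

/-- The space `M(S, K)` of marked simple counting measures on `S` with marks in `K`, each identified
with its support in `S × K`: the projection to `S` is simple (different points of the configuration
have different positions in `S`) and locally finite. -/
structure MarkedConfig (S K : Type*) [TopologicalSpace S] where
  carrier : Set (S × K)
  simple : Set.InjOn Prod.fst carrier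
  locallyFinite : ∀ s : S, ∃ U ∈ 𝓝 s, {x ∈ carrier | x.1 ∈ U}.Finite

namespace MarkedConfig

variable {S K : Type*} [TopologicalSpace S]

/-- `γ(B)`, the number of points of `γ` in `B`. -/
noncomputable def count (γ : MarkedConfig S K) (B : Set (S × K)) : ℕ∞ :=
  (γ.carrier ∩ B).encard

/-- The σ-algebra generated by the counts `γ ↦ γ(B)`, `B` measurable. -/
noncomputable instance [MeasurableSpace S] [MeasurableSpace K] : MeasurableSpace (MarkedConfig S K) :=
  ⨆ B : {B : Set (S × K) // MeasurableSet B},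
    MeasurableSpace.comap (fun γ : MarkedConfig S K => γ.count B.1) inferInstance

end MarkedConfig

/-- The Poisson distribution on `{0, 1, 2, …, ∞}` with mean `m ∈ [0, ∞]`; the one with infinite mean
is the point mass at `∞`. -/
noncomputable def extPoisson (m : ℝ≥0∞) : Measure ℕ∞ :=
  if m = ∞ then Measure.dirac ⊤ else (poissonMeasure m.toNNReal).map (fun n : ℕ => (n : ℕ∞))

/-- `Φ` is a Poisson point process with intensity measure `ν` on `S × K`: it is a random element of
`M(S, K)`, the number of points in any measurable set `B` is Poisson with mean `ν B`, and the numbers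
of points in finitely many pairwise disjoint measurable sets are independent. -/
structure IsPoissonProcess {S K Ω : Type*} [TopologicalSpace S] [MeasurableSpace S]
    [MeasurableSpace K] [MeasurableSpace Ω] (Φ : Ω → MarkedConfig S K) (ν : Measure (S × K))
    (P : Measure Ω) : Prop where
  measurable : Measurable Φ
  map_count : ∀ B : Set (S × K), MeasurableSet B →
    P.map (fun ω => (Φ ω).count B) = extPoisson (ν B)
  indep : ∀ (n : ℕ) (B : Fin n → Set (S × K)), (∀ i, MeasurableSet (B i)) →
    Pairwise (fun i j => Disjoint (B i) (B j)) →
    iIndepFun (fun i ω => (Φ ω).count (B i)) P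

/-- Realizations of the arrivals: a point is `((p, b), (c, w))` with position `p`, arrival time `b`,
color `c` and patience `w`. -/
abbrev Arrivals (D : Type*) [TopologicalSpace D] := MarkedConfig (D × ℝ) (Color × ℝ)

/-- The law of the mark of a particle: a uniform color and, independently, an exponential patience
with parameter `μ`. -/
noncomputable def markLaw (μ : ℝ) : Measure (Color × ℝ) :=
  (PMF.uniformOfFintype Color).toMeasure.prod (expMeasure μ)

/-- A Poisson point process of intensity `2 lam ⊗ ℓ` (`ℓ` is Lebesgue measure) on `D × ℝ` with
i.i.d. marks of law `markLaw μ`, that is, a Poisson point process on the product of `D × ℝ` and the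
space of marks with the product of the two measures as its intensity. -/
def IsArrivalProcess {D Ω : Type*} [TopologicalSpace D] [MeasurableSpace D] [MeasurableSpace Ω]
    (lam : Measure D) (μ : ℝ) (Φ : Ω → Arrivals D) (P : Measure Ω) : Prop :=
  IsPoissonProcess Φ (((2 : ℝ≥0∞) • lam.prod (volume : Measure ℝ)).prod (markLaw μ)) P

/-- `t` is a regeneration time: each particle with arrival time `b ≤ t` has a patience `w` with
`t - b > w`. -/
def IsRegenerationTime {D : Type*} [TopologicalSpace D] (φ : Arrivals D) (t : ℝ) : Prop :=
  ∀ x ∈ φ.carrier, x.1.2 ≤ t → t - x.1.2 > x.2.2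

open Filter Set

/-! Time `t` is a regeneration time iff no point lies in `survivors D t t`, a set of intensity
`2λ(D)/μ`; its void probability gives the bound. For the almost sure claim, look along `t = -k²`.
Survivors that arrived after `-(k+1)²` occupy disjoint sets for different `k`, so their absence
occurs infinitely often by the second Borel–Cantelli lemma. Older survivors have intensity
exponentially small in the gap `2k+1`, so by the first lemma they are eventually absent.
`ae_frequently_void` combines the two, and `measure_survivors` supplies the intensities. -/

lemma extPoisson_singleton_zero {m : ℝ≥0∞} (hm : m ≠ ∞) :
    extPoisson m {0} = ENNReal.ofReal (Real.exp (-m.toReal)) := by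
  rw [extPoisson, if_neg hm, Measure.map_apply .of_discrete (measurableSet_singleton _)]
  have h : (fun n : ℕ => (n : ℕ∞)) ⁻¹' {0} = {0} := by ext n; simp
  rw [h, poissonMeasure_singleton]
  simp [ENNReal.coe_toNNReal_eq_toReal]

namespace MarkedConfig

variable {S K : Type*} [TopologicalSpace S]

lemma measurable_count [MeasurableSpace S] [MeasurableSpace K] {B : Set (S × K)}
    (hB : MeasurableSet B) : Measurable fun γ : MarkedConfig S K => γ.count B :=
  measurable_iff_comap_le.2 <| le_iSup (fun B : {B : Set (S × K) // MeasurableSet B} =>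
    MeasurableSpace.comap (fun γ : MarkedConfig S K => γ.count B.1) inferInstance) ⟨B, hB⟩

lemma count_eq_zero_iff {γ : MarkedConfig S K} {B : Set (S × K)} :
    γ.count B = 0 ↔ Disjoint γ.carrier B := by
  rw [count, Set.encard_eq_zero, Set.disjoint_iff_inter_eq_empty]

lemma count_eq_zero_of_diff {γ : MarkedConfig S K} {A B : Set (S × K)}
    (hdiff : γ.count (A \ B) = 0) (hB : γ.count B = 0) : γ.count A = 0 := by
  rw [count_eq_zero_iff] at *
  exact (disjoint_union_right.2 ⟨hdiff, hB⟩).mono_right (by simp [subset_union_left])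

end MarkedConfig

namespace IsPoissonProcess

variable {S K Ω : Type*} [TopologicalSpace S] [MeasurableSpace S] [MeasurableSpace K]
  [MeasurableSpace Ω] {Φ : Ω → MarkedConfig S K} {ν : Measure (S × K)} {P : Measure Ω}

lemma measurable_count (hΦ : IsPoissonProcess Φ ν P) {B : Set (S × K)} (hB : MeasurableSet B) :
    Measurable fun ω => (Φ ω).count B :=
  (MarkedConfig.measurable_count hB).comp hΦ.measurable

lemma measurableSet_void (hΦ : IsPoissonProcess Φ ν P) {B : Set (S × K)} (hB : MeasurableSet B) :
    MeasurableSet {ω | (Φ ω).count B = 0} :=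
  hΦ.measurable_count hB (measurableSet_singleton 0)

lemma measure_void (hΦ : IsPoissonProcess Φ ν P) {B : Set (S × K)} (hB : MeasurableSet B)
    (hν : ν B ≠ ∞) :
    P {ω | (Φ ω).count B = 0} = ENNReal.ofReal (Real.exp (-(ν B).toReal)) := by
  rw [← extPoisson_singleton_zero hν, ← hΦ.map_count B hB,
    Measure.map_apply (hΦ.measurable_count hB) (measurableSet_singleton _)]
  rfl

lemma measure_count_ne_zero_le [IsProbabilityMeasure P] (hΦ : IsPoissonProcess Φ ν P)
    {B : Set (S × K)} (hB : MeasurableSet B) : P {ω | (Φ ω).count B ≠ 0} ≤ ν B := by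
  by_cases hν : ν B = ∞
  · simp [hν]
  have h : {ω | (Φ ω).count B ≠ 0} = {ω | (Φ ω).count B = 0}ᶜ := rfl
  rw [h, prob_compl_eq_one_sub (hΦ.measurableSet_void hB), hΦ.measure_void hB hν,
    ← ENNReal.ofReal_one, ← ENNReal.ofReal_sub _ (Real.exp_pos _).le]
  refine ENNReal.ofReal_le_of_le_toReal ?_
  -- `1 - e^{-m} ≤ m`.
  linarith [Real.add_one_le_exp (-(ν B).toReal)]

/-- Independence only tests finitely many indices, and these lie in some `Fin n`. -/
lemma iIndepFun_count (hΦ : IsPoissonProcess Φ ν P) {B : ℕ → Set (S × K)}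
    (hB : ∀ i, MeasurableSet (B i)) (hd : Pairwise fun i j => Disjoint (B i) (B j)) :
    iIndepFun (fun i ω => (Φ ω).count (B i)) P := by
  rw [iIndepFun_iff_measure_inter_preimage_eq_mul]
  intro T sets hsets
  obtain ⟨n, hn⟩ : ∃ n, ∀ i ∈ T, i < n :=
    ⟨T.sup id + 1, fun i hi => Nat.lt_succ_of_le (Finset.le_sup (f := id) hi)⟩
  obtain ⟨U, rfl⟩ : ∃ U : Finset (Fin n), U.map Fin.valEmbedding = T :=
    ⟨T.attachFin hn, Finset.map_valEmbedding_attachFin hn⟩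
  have h := (hΦ.indep n (fun i => B i) (fun i => hB i)
    fun i j hij => hd fun h => hij (Fin.ext h)).measure_inter_preimage_eq_mul
      U (sets := fun i => sets i) fun i hi => hsets _ (Finset.mem_map_of_mem _ hi)
  simpa using h

lemma iIndepSet_void (hΦ : IsPoissonProcess Φ ν P) {B : ℕ → Set (S × K)}
    (hB : ∀ i, MeasurableSet (B i)) (hd : Pairwise fun i j => Disjoint (B i) (B j)) :
    iIndepSet (fun i => {ω | (Φ ω).count (B i) = 0}) P := by
  rw [iIndepSet_iff_meas_biInter fun i => hΦ.measurableSet_void (hB i)]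
  intro T
  exact (hΦ.iIndepFun_count hB hd).measure_inter_preimage_eq_mul T (sets := fun _ => {0})
    fun i _ => measurableSet_singleton _

/-- If the sets `A i \ B i` are disjoint with bounded intensities and the intensities of the `B i`
are summable, then almost surely infinitely many of the `A i` contain no point. -/
lemma ae_frequently_void [IsProbabilityMeasure P] (hΦ : IsPoissonProcess Φ ν P)
    {A B : ℕ → Set (S × K)} (hA : ∀ i, MeasurableSet (A i)) (hB : ∀ i, MeasurableSet (B i))
    (hd : Pairwise fun i j => Disjoint (A i \ B i) (A j \ B j)) {C : ℝ≥0∞} (hC : C ≠ ∞)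
    (hAC : ∀ i, ν (A i) ≤ C) (hsum : ∑' i, ν (B i) ≠ ∞) :
    ∀ᵐ ω ∂P, ∃ᶠ i in atTop, (Φ ω).count (A i) = 0 := by
  have hAB i : MeasurableSet (A i \ B i) := (hA i).diff (hB i)
  have hle i : ν (A i \ B i) ≤ C := (measure_mono sdiff_subset).trans (hAC i)
  have hdiv : ∑' i, P {ω | (Φ ω).count (A i \ B i) = 0} = ∞ := by
    refine top_unique ?_
    calc ∞ = ∑' _ : ℕ, ENNReal.ofReal (Real.exp (-C.toReal)) :=
          (ENNReal.tsum_const_eq_top_of_ne_zero (by simp [Real.exp_pos])).symm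
      _ ≤ _ := ENNReal.tsum_le_tsum fun i => by
          rw [hΦ.measure_void (hAB i) (ne_top_of_le_ne_top hC (hle i))]
          gcongr
          exact hle i
  have hfreq : ∀ᵐ ω ∂P, ∃ᶠ i in atTop, (Φ ω).count (A i \ B i) = 0 := by
    have hone := measure_limsup_eq_one (fun i => hΦ.measurableSet_void (hAB i))
      (hΦ.iIndepSet_void hAB hd) hdiv
    have hmem := (mem_ae_iff_prob_eq_one
      (MeasurableSet.measurableSet_limsup fun i => hΦ.measurableSet_void (hAB i))).2 hone
    filter_upwards [hmem] with ω hω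
    rwa [mem_limsup_iff_frequently_mem] at hω
  have hev : ∀ᵐ ω ∂P, ∀ᶠ i in atTop, ¬ (Φ ω).count (B i) ≠ 0 :=
    ae_eventually_notMem (s := fun i => {ω | (Φ ω).count (B i) ≠ 0}) <|
      ne_top_of_le_ne_top hsum <| ENNReal.tsum_le_tsum fun i => hΦ.measure_count_ne_zero_le (hB i)
  filter_upwards [hfreq, hev] with ω h₁ h₂
  exact (h₁.and_eventually h₂).mono fun i hi =>
    MarkedConfig.count_eq_zero_of_diff hi.1 (not_not.1 hi.2)

end IsPoissonProcess

/-- The half-line is closed because regeneration asks for the strict inequality `w < t - b`. -/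
lemma expMeasure_Ici {μ : ℝ} (hμ : 0 < μ) {a : ℝ} (ha : 0 ≤ a) :
    expMeasure μ (Ici a) = ENNReal.ofReal (Real.exp (-(μ * a))) := by
  have := isProbabilityMeasure_expMeasure hμ
  have hac : expMeasure μ ≪ volume := withDensity_absolutelyContinuous _ _
  have hatom : expMeasure μ {a} = 0 := hac (by simp)
  have hIoi : expMeasure μ (Ici a) = expMeasure μ (Ioi a) := by
    refine le_antisymm ?_ (measure_mono Ioi_subset_Ici_self)
    rw [← Ioi_insert]
    refine (measure_union_le {a} (Ioi a)).trans ?_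
    simp [hatom]
  have hcdf := cdf_expMeasure_eq hμ a
  rw [if_pos ha, cdf_eq_real, measureReal_def] at hcdf
  rw [hIoi, ← compl_Iic, prob_compl_eq_one_sub measurableSet_Iic,
    ← ENNReal.ofReal_toReal (measure_ne_top (expMeasure μ) (Iic a)), hcdf, ← ENNReal.ofReal_one,
    ← ENNReal.ofReal_sub _ (by simpa using mul_nonneg hμ.le ha)]
  simp

lemma markLaw_snd_ge {μ : ℝ} (hμ : 0 < μ) {a : ℝ} (ha : 0 ≤ a) :
    markLaw μ {m | a ≤ m.2} = ENNReal.ofReal (Real.exp (-(μ * a))) := by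
  have := isProbabilityMeasure_expMeasure hμ
  have h : {m : Color × ℝ | a ≤ m.2} = univ ×ˢ Ici a := by ext; simp
  rw [markLaw, h, Measure.prod_prod, expMeasure_Ici hμ ha, measure_univ, one_mul]

/-- The space-time-mark points that arrive at or before time `s` and prevent `t` from being a
regeneration time. -/
def survivors (D : Type*) (t s : ℝ) : Set ((D × ℝ) × (Color × ℝ)) :=
  {x | x.1.2 ≤ s ∧ t - x.1.2 ≤ x.2.2}

section

variable {D : Type*}

lemma isRegenerationTime_iff_count [TopologicalSpace D] {φ : Arrivals D} {t : ℝ} :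
    IsRegenerationTime φ t ↔ φ.count (survivors D t t) = 0 := by
  rw [MarkedConfig.count_eq_zero_iff, Set.disjoint_left]
  simp only [IsRegenerationTime, survivors, mem_ofPred_eq, not_and, not_le, gt_iff_lt]

variable [MeasurableSpace D]

lemma measurableSet_survivors (t s : ℝ) : MeasurableSet (survivors D t s) :=
  (measurableSet_le (f := fun x : (D × ℝ) × (Color × ℝ) => x.1.2) (by fun_prop)
    measurable_const).inter (measurableSet_le (f := fun x : (D × ℝ) × (Color × ℝ) => t - x.1.2)
      (g := fun x => x.2.2) (by fun_prop) (by fun_prop))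

/-- A particle born at `b` survives to `t` with probability `e^{-μ(t-b)}`; integrate over `b ≤ s`.
-/
lemma measure_survivors (lam : Measure D) [IsFiniteMeasure lam] {μ : ℝ} (hμ : 0 < μ) {s t : ℝ}
    (hst : s ≤ t) :
    ((2 : ℝ≥0∞) • lam.prod (volume : Measure ℝ)).prod (markLaw μ) (survivors D t s) =
      ENNReal.ofReal (2 * lam.real univ / μ * Real.exp (-(μ * (t - s)))) := by
  have := isProbabilityMeasure_expMeasure hμ
  have : SFinite (markLaw μ) := by unfold markLaw; infer_instance
  have hfib : ∀ x : D × ℝ, markLaw μ (Prod.mk x ⁻¹' survivors D t s) =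
      (Iic s).indicator (fun b => ENNReal.ofReal (Real.exp (-(μ * (t - b))))) x.2 := by
    intro x
    by_cases hx : x.2 ≤ s
    · rw [indicator_of_mem (mem_Iic.2 hx), ← markLaw_snd_ge hμ (by linarith)]
      simp [survivors, hx]
    · rw [indicator_of_notMem (by simpa using hx)]
      simp [survivors, hx]
  have hmeas : Measurable fun b : ℝ => ENNReal.ofReal (Real.exp (-(μ * (t - b)))) := by fun_prop
  have hexp : ∀ b : ℝ, Real.exp (-(μ * (t - b))) = Real.exp (-(μ * t)) * Real.exp (μ * b) := by
    intro b
    rw [← Real.exp_add]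
    ring_nf
  have hint : ∫⁻ b in Iic s, ENNReal.ofReal (Real.exp (-(μ * (t - b)))) =
      ENNReal.ofReal (Real.exp (-(μ * (t - s))) / μ) := by
    simp_rw [hexp]
    rw [← ofReal_integral_eq_lintegral_ofReal ((integrableOn_exp_mul_Iic hμ s).const_mul _)
      (Eventually.of_forall fun _ => by positivity), integral_const_mul, integral_exp_mul_Iic hμ,
      mul_div_assoc]
  rw [Measure.prod_apply (measurableSet_survivors t s), lintegral_smul_measure]
  simp_rw [hfib]
  have hind : Measurable fun x : D × ℝ =>
      (Iic s).indicator (fun b => ENNReal.ofReal (Real.exp (-(μ * (t - b))))) x.2 :=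
    (hmeas.indicator measurableSet_Iic).comp measurable_snd
  rw [lintegral_prod _ hind.aemeasurable]
  simp only [lintegral_indicator measurableSet_Iic, hint, lintegral_const]
  rw [← ofReal_measureReal (μ := lam), ← ENNReal.ofReal_mul (by positivity), smul_eq_mul,
    ← ENNReal.ofReal_ofNat 2, ← ENNReal.ofReal_mul (by positivity)]
  congr 1
  ring

end

theorem mainTheorem11 {D : Type*} [MetricSpace D] [CompactSpace D] [MeasurableSpace D]
    [BorelSpace D] (lam : Measure D) [IsFiniteMeasure lam] (μ : ℝ) (hμ : 0 < μ)
    {Ω : Type*} [MeasurableSpace Ω] (P : Measure Ω) [IsProbabilityMeasure P]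
    (Φ : Ω → Arrivals D) (hΦ : IsArrivalProcess lam μ Φ P) :
    (∀ᵐ ω ∂P, {n : ℕ | IsRegenerationTime (Φ ω) (-(n : ℝ))}.Infinite) ∧
      ENNReal.ofReal (Real.exp (-2 * lam.real Set.univ / μ)) ≤
        P {ω | IsRegenerationTime (Φ ω) 0} := by
  have hν {s t : ℝ} (hst : s ≤ t) := measure_survivors lam hμ hst
  constructor
  · have hsq : ∀ k : ℕ, -((k + 1 : ℕ) : ℝ) ^ 2 ≤ -(k : ℝ) ^ 2 := fun k => by
      push_cast
      nlinarith [(Nat.cast_nonneg k : (0 : ℝ) ≤ k)]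
    have hfreq := hΦ.ae_frequently_void
      (A := fun k : ℕ => survivors D (-(k : ℝ) ^ 2) (-(k : ℝ) ^ 2))
      (B := fun k : ℕ => survivors D (-(k : ℝ) ^ 2) (-((k + 1 : ℕ) : ℝ) ^ 2))
      (C := ENNReal.ofReal (2 * lam.real univ / μ))
      (fun k => measurableSet_survivors _ _) (fun k => measurableSet_survivors _ _)
      ?_ ENNReal.ofReal_ne_top (fun k => by simp [hν le_rfl]) ?_
    · filter_upwards [hfreq] with ω hω
      -- Squaring is injective, so infinitely many `k` give infinitely many `n = k²`.
      refine ((Nat.frequently_atTop_iff_infinite.1 hω).image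
        (Nat.pow_left_injective two_ne_zero).injOn).mono ?_
      rintro _ ⟨k, hk, rfl⟩
      simpa [isRegenerationTime_iff_count] using hk
    -- For `i < j`, a point of the `j`-th set arrives by `-j² ≤ -(i+1)²`, which the `i`-th set
    -- excludes.
    · refine (pairwise_disjoint_on _).2 fun i j hij =>
        Set.disjoint_left.2 fun x hi hj => hi.2 ⟨hj.1.1.trans ?_, hi.1.2⟩
      have : ((i + 1 : ℕ) : ℝ) ≤ j := by exact_mod_cast hij
      gcongr
    · simp_rw [hν (hsq _)]
      -- As `2k+1 ≥ k`, the geometric series of `e^{-μk}` dominates.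
      refine Summable.tsum_ofReal_ne_top <| Summable.mul_left _ <|
        Summable.of_nonneg_of_le (fun _ => (Real.exp_pos _).le) (fun k => ?_)
          (Real.summable_exp_nat_mul_iff.2 (neg_lt_zero.2 hμ))
      rw [Real.exp_le_exp]
      push_cast
      nlinarith [mul_nonneg hμ.le (Nat.cast_nonneg k : (0 : ℝ) ≤ k)]
  · simp_rw [isRegenerationTime_iff_count]
    rw [hΦ.measure_void (measurableSet_survivors 0 0) (by simp [hν le_rfl]), hν le_rfl,
      ENNReal.toReal_ofReal (by positivity)]
    refine (congrArg (fun r => ENNReal.ofReal (Real.exp r)) ?_).le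
    simp
    ring
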